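/- Let $x\in\mathbb{R}^n$, let $O$ be the algebra of germs at $x$ of complex-valued real-analytic functions, and let $D$ be the algebra of differential operators with coefficients in $O$, filtered by $D_k=\{a\in D:\operatorname{ord}a\le k\}$ for $k\in\mathbb{Z}$ (so $D_k=0$ for $k<0$), with associated graded algebra $\operatorname{gr}D=\bigoplus_k D_k/D_{k-1}$. A filtered left $D$-module is a left $D$-module $M$ with an increasing filtration by additive subgroups $M_k$, $k\in\mathbb{Z}$, such that $\bigcup_k M_k=M$ and $D_iM_k\subset M_{i+k}$ (so every $M_k$ is an $O$-submodule); $\operatorname{gr}M=\bigoplus_k M_k/M_{k-1}$ is then a graded $\operatorname{gr}D$-module. For $r\ge 0$ and a shift vector $\rho\in\mathbb{Z}^r$, let $D^\rho$ be the free left module $D^r$ with the filtration $D^\rho_k=\{(a_1,\dots,a_r):\operatorname{ord}a_j+\rho_j\le k\text{ for all }j\}$. A $D$-morphism $\alpha:E\to F$ of filtered modules agrees with the filtrations if $\alpha(E_k)\subset F_k$ for all $k$, and then it induces $\operatorname{gr}\alpha:\operatorname{gr}E\to\operatorname{gr}F$; it is strict if moreover $\alpha(E_k)=\alpha(E)\cap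 F_k$ for all $k\in\mathbb{Z}$. Let $M$ be a filtered left $D$-module with $\bigcap_k M_k=0$, and let $$\cdots\to\operatorname{gr}D^{\rho_2}\xrightarrow{\ \mathrm{P}_1\ }\operatorname{gr}D^{\rho_1}\xrightarrow{\ \mathrm{P}_0\ }\operatorname{gr}D^{\rho_0}\xrightarrow{\ \mathrm{p}\ }\operatorname{gr}M\to0$$ be an exact sequence of $\operatorname{gr}D$-morphisms of degree $0$, where $\rho_i\in\mathbb{Z}^{r_i}$ are shift vectors (a free graded resolution of $\operatorname{gr}M$). Then there exists an exact sequence $$\cdots\to D^{\rho_2'}\xrightarrow{\ P_1\ }D^{\rho_1'}\xrightarrow{\ P_0\ }D^{\rho_0'}\xrightarrow{\ \pi\ }M\to0$$ of strict morphisms of filtered left $D$-modules whose principal part is the given resolution: the ranks and the shift vectors are the same, $\rho_i'=\rho_i$, and $\operatorname{gr}\pi=\mathrm{p}$, $\operatorname{gr}P_i=\mathrm{P}_i$ for all $i\ge 0$. -/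

import Mathlib

open Filter Topology DirectSum

noncomputable section

/-! ### Analytic germs and differential operators -/

/-- The ring of germs at `x` of complex-valued real-analytic functions on `ℝⁿ`. -/
def analyticGermSubring {n : ℕ} (x : EuclideanSpace ℝ (Fin n)) : Subring (Germ (𝓝 x) ℂ) where
  carrier := {g | ∃ f : EuclideanSpace ℝ (Fin n) → ℂ, AnalyticAt ℝ f x ∧ g = (f : Germ (𝓝 x) ℂ)}
  mul_mem' := by
    rintro _ _ ⟨f, hf, rfl⟩ ⟨g, hg, rfl⟩
    exact ⟨f * g, hf.mul hg, rfl⟩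
  one_mem' := ⟨fun _ => 1, analyticAt_const, rfl⟩
  add_mem' := by
    rintro _ _ ⟨f, hf, rfl⟩ ⟨g, hg, rfl⟩
    exact ⟨f + g, hf.add hg, rfl⟩
  zero_mem' := ⟨fun _ => 0, analyticAt_const, rfl⟩
  neg_mem' := by
    rintro _ ⟨f, hf, rfl⟩
    exact ⟨-f, hf.neg, rfl⟩

/-- The algebra `O = O_x` of germs at `x` of analytic functions. -/
abbrev AnalyticGerm {n : ℕ} (x : EuclideanSpace ℝ (Fin n)) : Type := analyticGermSubring x

namespace AnalyticGerm

variable {n : ℕ} {x : EuclideanSpace ℝ (Fin n)}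

/-- The germ at `x` of a function that is analytic at `x`. -/
def mk (f : EuclideanSpace ℝ (Fin n) → ℂ) (hf : AnalyticAt ℝ f x) : AnalyticGerm x :=
  ⟨(f : Germ (𝓝 x) ℂ), f, hf, rfl⟩

theorem mk_eq_mk {f g : EuclideanSpace ℝ (Fin n) → ℂ} {hf : AnalyticAt ℝ f x}
    {hg : AnalyticAt ℝ g x} : mk f hf = mk g hg ↔ f =ᶠ[𝓝 x] g :=
  Subtype.ext_iff.trans Germ.coe_eq

theorem exists_rep (g : AnalyticGerm x) :
    ∃ f : EuclideanSpace ℝ (Fin n) → ℂ, ∃ hf : AnalyticAt ℝ f x, g = mk f hf := by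
  obtain ⟨_, f, hf, rfl⟩ := g
  exact ⟨f, hf, rfl⟩

/-- The embedding of the constants into the analytic germs. -/
def const (x : EuclideanSpace ℝ (Fin n)) : ℂ →+* AnalyticGerm x where
  toFun c := mk (fun _ => c) analyticAt_const
  map_one' := rfl
  map_mul' _ _ := rfl
  map_zero' := rfl
  map_add' _ _ := rfl

instance : Algebra ℂ (AnalyticGerm x) := (const x).toAlgebra

theorem analyticAt_partial {f : EuclideanSpace ℝ (Fin n) → ℂ} (hf : AnalyticAt ℝ f x)
    (i : Fin n) :
    AnalyticAt ℝ (fun y => fderiv ℝ f y (EuclideanSpace.single i 1)) x :=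
  ((ContinuousLinearMap.apply ℝ ℂ
    (EuclideanSpace.single i (1 : ℝ))).analyticAt _).comp hf.fderiv

/-- The partial derivative `∂/∂xᵢ` of an analytic germ. -/
def partialFun (i : Fin n) (g : AnalyticGerm x) : AnalyticGerm x :=
  mk (fun y => fderiv ℝ (exists_rep g).choose y (EuclideanSpace.single i 1))
    (analyticAt_partial (exists_rep g).choose_spec.choose i)

/-- The partial derivative of a germ is computed with any representative of the germ. -/
theorem partialFun_mk (i : Fin n) (f : EuclideanSpace ℝ (Fin n) → ℂ) (hf : AnalyticAt ℝ f x) :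
    partialFun i (mk f hf) =
      mk (fun y => fderiv ℝ f y (EuclideanSpace.single i 1)) (analyticAt_partial hf i) := by
  have h := mk_eq_mk.1 (exists_rep (mk f hf)).choose_spec.choose_spec
  refine mk_eq_mk.2 ?_
  filter_upwards [h.fderiv (𝕜 := ℝ)] with y hy
  rw [hy]

theorem partialFun_add (i : Fin n) (g h : AnalyticGerm x) :
    partialFun i (g + h) = partialFun i g + partialFun i h := by
  obtain ⟨f, hf, rfl⟩ := exists_rep g
  obtain ⟨k, hk, rfl⟩ := exists_rep h
  change partialFun i (mk (f + k) (hf.add hk)) = _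
  rw [partialFun_mk, partialFun_mk, partialFun_mk]
  refine Subtype.ext (Germ.coe_eq.2 ?_)
  filter_upwards [hf.eventually_analyticAt, hk.eventually_analyticAt] with y h1 h2
  rw [fderiv_add h1.differentiableAt h2.differentiableAt]
  rfl

/-- The Leibniz rule. -/
theorem partialFun_mul (i : Fin n) (g h : AnalyticGerm x) :
    partialFun i (g * h) = g * partialFun i h + partialFun i g * h := by
  obtain ⟨f, hf, rfl⟩ := exists_rep g
  obtain ⟨k, hk, rfl⟩ := exists_rep h
  change partialFun i (mk (f * k) (hf.mul hk)) = _
  rw [partialFun_mk, partialFun_mk, partialFun_mk]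
  refine Subtype.ext (Germ.coe_eq.2 ?_)
  filter_upwards [hf.eventually_analyticAt, hk.eventually_analyticAt] with y h1 h2
  rw [fderiv_mul h1.differentiableAt h2.differentiableAt]
  simp [mul_comm]

theorem partialFun_const (i : Fin n) (c : ℂ) : partialFun i (const x c) = 0 := by
  change partialFun i (mk (fun _ => c) analyticAt_const) = _
  rw [partialFun_mk]
  refine Subtype.ext (Germ.coe_eq.2 <| Eventually.of_forall fun y => ?_)
  simp

end AnalyticGerm

open AnalyticGerm

variable {n : ℕ}

/-- The partial derivative `∂/∂xᵢ` as a `ℂ`-linear operator on the germs at `x`. -/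
def partialOp (x : EuclideanSpace ℝ (Fin n)) (i : Fin n) : Module.End ℂ (AnalyticGerm x) where
  toFun := partialFun i
  map_add' := partialFun_add i
  map_smul' c g := by
    rw [Algebra.smul_def, RingHom.id_apply, Algebra.smul_def, partialFun_mul]
    change _ + partialFun i (const x c) * g = _
    rw [partialFun_const, zero_mul, add_zero]

/-- The algebra `D` of differential operators with coefficients in `O`: the `ℂ`-algebra of
operators on `O` that is generated by the multiplications by elements of `O` and by the partial
derivatives. -/
def diffOpAlgebra (x : EuclideanSpace ℝ (Fin n)) : Subalgebra ℂ (Module.End ℂ (AnalyticGerm x)) :=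
  Algebra.adjoin ℂ (Set.range (LinearMap.mulLeft ℂ : AnalyticGerm x → _) ∪
    Set.range (partialOp x))

/-- The ring `D = D_x` of differential operators. -/
abbrev DiffOp (x : EuclideanSpace ℝ (Fin n)) : Type := diffOpAlgebra x

/-- The operators of order at most `k`: the `O`-linear combinations of compositions of at most `k`
partial derivatives (so only `0` if `k < 0`). -/
def orderLE (x : EuclideanSpace ℝ (Fin n)) (k : ℤ) :
    Submodule (AnalyticGerm x) (Module.End ℂ (AnalyticGerm x)) :=
  Submodule.span (AnalyticGerm x)
    {w | ∃ l : List (Fin n), (l.length : ℤ) ≤ k ∧ w = (l.map (partialOp x)).prod}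

theorem orderLE_mono (x : EuclideanSpace ℝ (Fin n)) : Monotone (orderLE x) := by
  intro i j hij
  refine Submodule.span_mono ?_
  rintro _ ⟨l, hl, rfl⟩
  exact ⟨l, hl.trans hij, rfl⟩

theorem partialOp_mul_smul (x : EuclideanSpace ℝ (Fin n)) (i : Fin n) (f : AnalyticGerm x)
    (w : Module.End ℂ (AnalyticGerm x)) :
    partialOp x i * (f • w) = f • (partialOp x i * w) + partialFun i f • w := by
  ext g : 1
  exact partialFun_mul i f (w g)

theorem partialOp_mul_mem {x : EuclideanSpace ℝ (Fin n)} (i : Fin n) {k : ℤ}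
    {w : Module.End ℂ (AnalyticGerm x)} (hw : w ∈ orderLE x k) :
    partialOp x i * w ∈ orderLE x (k + 1) := by
  induction hw using Submodule.span_induction with
  | mem w h =>
    obtain ⟨l, hl, rfl⟩ := h
    exact Submodule.subset_span ⟨i :: l, by push_cast [List.length_cons]; omega, by simp⟩
  | zero => simp
  | add v w _ _ hv hw => rw [mul_add]; exact add_mem hv hw
  | smul f w hw' hw =>
    rw [partialOp_mul_smul]
    exact add_mem (Submodule.smul_mem _ _ hw)
      (Submodule.smul_mem _ _ (orderLE_mono x (by omega) hw'))

theorem orderLE_mul_mem {x : EuclideanSpace ℝ (Fin n)} {i j : ℤ}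
    {v w : Module.End ℂ (AnalyticGerm x)} (hv : v ∈ orderLE x i) (hw : w ∈ orderLE x j) :
    v * w ∈ orderLE x (i + j) := by
  induction hv using Submodule.span_induction with
  | mem v h =>
    obtain ⟨l, hl, rfl⟩ := h
    refine orderLE_mono x (show (l.length : ℤ) + j ≤ i + j by omega) ?_
    clear hl
    induction l with
    | nil => simpa using hw
    | cons a l ih =>
      rw [List.map_cons, List.prod_cons, mul_assoc]
      refine orderLE_mono x ?_ (partialOp_mul_mem a ih)
      push_cast [List.length_cons]
      omega
  | zero => simp
  | add u v _ _ hu hv => rw [add_mul]; exact add_mem hu hv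
  | smul f v _ hv => rw [smul_mul_assoc]; exact Submodule.smul_mem _ _ hv

theorem one_mem_orderLE (x : EuclideanSpace ℝ (Fin n)) :
    (1 : Module.End ℂ (AnalyticGerm x)) ∈ orderLE x 0 :=
  Submodule.subset_span ⟨[], by simp, by simp⟩

theorem mulLeft_mem_orderLE {x : EuclideanSpace ℝ (Fin n)} (f : AnalyticGerm x) :
    LinearMap.mulLeft ℂ f ∈ orderLE x 0 := by
  have h : LinearMap.mulLeft ℂ f = f • (1 : Module.End ℂ (AnalyticGerm x)) := rfl
  rw [h]
  exact Submodule.smul_mem _ _ (one_mem_orderLE x)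

theorem exists_mem_orderLE {x : EuclideanSpace ℝ (Fin n)} {w : Module.End ℂ (AnalyticGerm x)}
    (hw : w ∈ diffOpAlgebra x) : ∃ k, w ∈ orderLE x k := by
  induction hw using Algebra.adjoin_induction with
  | mem w h =>
    rcases h with ⟨f, rfl⟩ | ⟨i, rfl⟩
    · exact ⟨0, mulLeft_mem_orderLE f⟩
    · exact ⟨1, Submodule.subset_span ⟨[i], by simp, by simp⟩⟩
  | algebraMap c =>
    refine ⟨0, ?_⟩
    have h : algebraMap ℂ (Module.End ℂ (AnalyticGerm x)) c = LinearMap.mulLeft ℂ (const x c) := by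
      ext g : 1
      rw [Module.algebraMap_end_apply, Algebra.smul_def]
      rfl
    rw [h]
    exact mulLeft_mem_orderLE _
  | add v w _ _ hv hw =>
    obtain ⟨i, hi⟩ := hv
    obtain ⟨j, hj⟩ := hw
    exact ⟨max i j, add_mem (orderLE_mono x (le_max_left i j) hi)
      (orderLE_mono x (le_max_right i j) hj)⟩
  | mul v w _ _ hv hw =>
    obtain ⟨i, hi⟩ := hv
    obtain ⟨j, hj⟩ := hw
    exact ⟨i + j, orderLE_mul_mem hi hj⟩

/-! ### Filtered rings and modules -/

/-- An increasing exhaustive filtration of a ring. -/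
structure RingFiltration (A : Type*) [Ring A] where
  /-- the `k`-th step of the filtration -/
  fil : ℤ → AddSubgroup A
  mono : Monotone fil
  one_mem : (1 : A) ∈ fil 0
  mul_mem : ∀ {i j : ℤ} {a b : A}, a ∈ fil i → b ∈ fil j → a * b ∈ fil (i + j)
  exhaustive : ∀ a : A, ∃ k, a ∈ fil k

/-- An increasing exhaustive filtration `M_k`, `k ∈ ℤ`, of a left module over a filtered ring, with
`A_i M_k ⊆ M_{i+k}`. -/
structure ModuleFiltration {A : Type*} [Ring A] (F : RingFiltration A) (M : Type*)
    [AddCommGroup M] [Module A M] where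
  /-- the `k`-th step of the filtration -/
  fil : ℤ → AddSubgroup M
  mono : Monotone fil
  smul_mem : ∀ {i k : ℤ} {a : A} {m : M}, a ∈ F.fil i → m ∈ fil k → a • m ∈ fil (i + k)
  exhaustive : ∀ m : M, ∃ k, m ∈ fil k

/-- The filtration of the ring of differential operators by the order. -/
def orderFiltration (x : EuclideanSpace ℝ (Fin n)) : RingFiltration (DiffOp x) where
  fil k := (orderLE x k).toAddSubgroup.comap (diffOpAlgebra x).val.toAddMonoidHom
  mono _ _ h _ ha := orderLE_mono x h ha
  one_mem := one_mem_orderLE x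
  mul_mem ha hb := orderLE_mul_mem ha hb
  exhaustive a := exists_mem_orderLE a.2

/-! ### Associated graded objects -/

section Graded

variable {A : Type*} [Ring A] {M N : Type*} [AddCommGroup M] [Module A M]
  [AddCommGroup N] [Module A N]

/-- The quotient `Φ_k / Φ_{k-1}`. -/
abbrev FilQuotient (Φ : ℤ → AddSubgroup M) (k : ℤ) : Type _ :=
  Φ k ⧸ (Φ (k - 1)).addSubgroupOf (Φ k)

/-- The map `Φ_i / Φ_{i-1} × Ψ_j / Ψ_{j-1} → Ψ_{i+j} / Ψ_{i+j-1}` induced by scalar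
multiplication. -/
def filQuotientSMul (Φ : ℤ → AddSubgroup A) (Ψ : ℤ → AddSubgroup M)
    (h : ∀ {i j : ℤ} {a : A} {m : M}, a ∈ Φ i → m ∈ Ψ j → a • m ∈ Ψ (i + j)) (i j : ℤ) :
    FilQuotient Φ i →+ FilQuotient Ψ j →+ FilQuotient Ψ (i + j) :=
  QuotientAddGroup.lift _
    { toFun := fun a => QuotientAddGroup.lift _
        { toFun := fun m => QuotientAddGroup.mk ⟨(a : A) • (m : M), h a.2 m.2⟩
          map_zero' := by
            refine (congrArg QuotientAddGroup.mk (Subtype.ext ?_)).trans (QuotientAddGroup.mk_zero _)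
            exact smul_zero _
          map_add' := fun m m' => by
            refine (congrArg QuotientAddGroup.mk (Subtype.ext ?_)).trans
              (QuotientAddGroup.mk_add _ _ _)
            exact smul_add _ _ _ }
        (fun m hm => (QuotientAddGroup.eq_zero_iff _).2 (by
          rw [AddSubgroup.mem_addSubgroupOf] at hm ⊢
          have := h a.2 hm
          rwa [← add_sub_assoc] at this))
      map_zero' := by
        ext m
        refine (congrArg QuotientAddGroup.mk (Subtype.ext ?_)).trans (QuotientAddGroup.mk_zero _)
        exact zero_smul _ _
      map_add' := fun a a' => by
        ext m
        refine (congrArg QuotientAddGroup.mk (Subtype.ext ?_)).trans (QuotientAddGroup.mk_add _ _ _)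
        exact add_smul _ _ _ }
    (fun a ha => by
      ext m
      refine (QuotientAddGroup.eq_zero_iff _).2 ?_
      rw [AddSubgroup.mem_addSubgroupOf] at ha ⊢
      have := h ha m.2
      rwa [sub_add_eq_add_sub] at this)

/-- The piece `A_k / A_{k-1}` of the associated graded ring. -/
def RingFiltration.GrPiece (F : RingFiltration A) (k : ℤ) : Type _ := FilQuotient F.fil k

/-- The piece `M_k / M_{k-1}` of the associated graded module. -/
def ModuleFiltration.GrPiece {F : RingFiltration A} (G : ModuleFiltration F M) (k : ℤ) : Type _ :=
  FilQuotient G.fil k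

instance (F : RingFiltration A) (k : ℤ) : AddCommGroup (F.GrPiece k) :=
  inferInstanceAs (AddCommGroup (FilQuotient F.fil k))

instance {F : RingFiltration A} (G : ModuleFiltration F M) (k : ℤ) : AddCommGroup (G.GrPiece k) :=
  inferInstanceAs (AddCommGroup (FilQuotient G.fil k))

/-- The class in `A_k / A_{k-1}` of an element of `A_k`. -/
def RingFiltration.symbol (F : RingFiltration A) (k : ℤ) : F.fil k →+ F.GrPiece k :=
  QuotientAddGroup.mk' _

/-- The class in `M_k / M_{k-1}` of an element of `M_k`. -/
def ModuleFiltration.symbol {F : RingFiltration A} (G : ModuleFiltration F M) (k : ℤ) :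
    G.fil k →+ G.GrPiece k :=
  QuotientAddGroup.mk' _

variable {F : RingFiltration A}

theorem RingFiltration.exists_symbol {k : ℤ} (a : F.GrPiece k) : ∃ b, F.symbol k b = a :=
  QuotientAddGroup.mk'_surjective _ a

theorem ModuleFiltration.exists_symbol {G : ModuleFiltration F M} {k : ℤ} (a : G.GrPiece k) :
    ∃ b, G.symbol k b = a :=
  QuotientAddGroup.mk'_surjective _ a

theorem RingFiltration.sigma_symbol_eq {i j : ℤ} (h : i = j) {a b : A} (ha : a ∈ F.fil i)
    (hb : b ∈ F.fil j) (hab : a = b) :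
    GradedMonoid.mk (A := F.GrPiece) i (F.symbol i ⟨a, ha⟩) =
      GradedMonoid.mk j (F.symbol j ⟨b, hb⟩) := by
  subst h hab
  rfl

theorem ModuleFiltration.sigma_symbol_eq {G : ModuleFiltration F M} {i j : ℤ} (h : i = j) {a b : M}
    (ha : a ∈ G.fil i) (hb : b ∈ G.fil j) (hab : a = b) :
    GradedMonoid.mk (A := G.GrPiece) i (G.symbol i ⟨a, ha⟩) =
      GradedMonoid.mk j (G.symbol j ⟨b, hb⟩) := by
  subst h hab
  rfl

/-- The product `A_i / A_{i-1} × A_j / A_{j-1} → A_{i+j} / A_{i+j-1}`, `[a] [b] = [a b]`. -/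
def RingFiltration.grMul (F : RingFiltration A) (i j : ℤ) :
    F.GrPiece i →+ F.GrPiece j →+ F.GrPiece (i + j) :=
  filQuotientSMul F.fil F.fil F.mul_mem i j

/-- The product `A_i / A_{i-1} × M_j / M_{j-1} → M_{i+j} / M_{i+j-1}`, `[a] [m] = [a m]`. -/
def ModuleFiltration.grSMul (G : ModuleFiltration F M) (i j : ℤ) :
    F.GrPiece i →+ G.GrPiece j →+ G.GrPiece (i + j) :=
  filQuotientSMul F.fil G.fil G.smul_mem i j

instance RingFiltration.gMul (F : RingFiltration A) : GradedMonoid.GMul F.GrPiece where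
  mul {i j} a b := F.grMul i j a b

instance RingFiltration.gOne (F : RingFiltration A) : GradedMonoid.GOne F.GrPiece where
  one := F.symbol 0 ⟨1, F.one_mem⟩

instance RingFiltration.gMonoid (F : RingFiltration A) : GradedMonoid.GMonoid F.GrPiece where
  one_mul := by
    rintro ⟨i, a⟩
    obtain ⟨a, rfl⟩ := F.exists_symbol a
    exact F.sigma_symbol_eq (zero_add i) _ a.2 (one_mul _)
  mul_one := by
    rintro ⟨i, a⟩
    obtain ⟨a, rfl⟩ := F.exists_symbol a
    exact F.sigma_symbol_eq (add_zero i) _ a.2 (mul_one _)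
  mul_assoc := by
    rintro ⟨i, a⟩ ⟨j, b⟩ ⟨k, c⟩
    obtain ⟨a, rfl⟩ := F.exists_symbol a
    obtain ⟨b, rfl⟩ := F.exists_symbol b
    obtain ⟨c, rfl⟩ := F.exists_symbol c
    exact F.sigma_symbol_eq (add_assoc i j k) _ _ (mul_assoc _ _ _)

/-- The ring structure of `gr A`. -/
instance RingFiltration.gRing (F : RingFiltration A) : DirectSum.GRing F.GrPiece where
  __ := F.gMonoid
  mul_zero a := map_zero (F.grMul _ _ a)
  zero_mul b := DFunLike.congr_fun (map_zero (F.grMul _ _)) b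
  mul_add a b c := map_add (F.grMul _ _ a) b c
  add_mul a b c := DFunLike.congr_fun (map_add (F.grMul _ _) a b) c
  natCast m := m • F.symbol 0 ⟨1, F.one_mem⟩
  natCast_zero := zero_nsmul _
  natCast_succ _ := succ_nsmul _ _
  intCast m := m • F.symbol 0 ⟨1, F.one_mem⟩
  intCast_ofNat _ := natCast_zsmul _ _
  intCast_negSucc_ofNat _ := negSucc_zsmul _ _

/-- The `gr A`-module structure of `gr M`. -/
instance ModuleFiltration.gModule (G : ModuleFiltration F M) :
    DirectSum.Gmodule F.GrPiece G.GrPiece where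
  smul {i j} a b := G.grSMul i j a b
  smul_zero a := map_zero (G.grSMul _ _ a)
  smul_add a b c := map_add (G.grSMul _ _ a) b c
  zero_smul b := DFunLike.congr_fun (map_zero (G.grSMul _ _)) b
  add_smul a b c := DFunLike.congr_fun (map_add (G.grSMul _ _) a b) c
  one_smul := by
    rintro ⟨i, a⟩
    obtain ⟨a, rfl⟩ := G.exists_symbol a
    exact G.sigma_symbol_eq (zero_add i) _ a.2 (one_smul _ _)
  mul_smul := by
    rintro ⟨i, a⟩ ⟨j, b⟩ ⟨k, c⟩
    obtain ⟨a, rfl⟩ := F.exists_symbol a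
    obtain ⟨b, rfl⟩ := F.exists_symbol b
    obtain ⟨c, rfl⟩ := G.exists_symbol c
    exact G.sigma_symbol_eq (add_assoc i j k) _ _ (mul_smul _ _ _)

/-- The associated graded ring `gr A`. -/
abbrev RingFiltration.Gr (F : RingFiltration A) : Type _ := ⨁ k, F.GrPiece k

/-- The associated graded module `gr M`, a module over `gr A`. -/
abbrev ModuleFiltration.Gr (G : ModuleFiltration F M) : Type _ := ⨁ k, G.GrPiece k

/-- The morphism `α` agrees with the filtrations. -/
def Agrees (G : ModuleFiltration F M) (H : ModuleFiltration F N) (α : M →ₗ[A] N) : Prop :=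
  ∀ k, ∀ m ∈ G.fil k, α m ∈ H.fil k

/-- The morphism `α` is strict: it agrees with the filtrations and `α(M_k) = α(M) ∩ N_k`. -/
def IsStrict (G : ModuleFiltration F M) (H : ModuleFiltration F N) (α : M →ₗ[A] N) : Prop :=
  Agrees G H α ∧ ∀ k, α '' (G.fil k : Set M) = Set.range α ∩ (H.fil k : Set N)

/-- The map `M_k / M_{k-1} → N_k / N_{k-1}` induced by a morphism that agrees with the
filtrations. -/
def grMapPiece {G : ModuleFiltration F M} {H : ModuleFiltration F N} (α : M →ₗ[A] N)
    (hα : Agrees G H α) (k : ℤ) : G.GrPiece k →+ H.GrPiece k :=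
  QuotientAddGroup.map _ _
    ((α.toAddMonoidHom.comp (G.fil k).subtype).codRestrict (H.fil k) fun m => hα k m m.2)
    (fun m hm => hα (k - 1) m hm)

/-- The morphism `gr α : gr M → gr N` of `gr A`-modules. -/
def grMap {G : ModuleFiltration F M} {H : ModuleFiltration F N} (α : M →ₗ[A] N)
    (hα : Agrees G H α) : G.Gr →ₗ[F.Gr] H.Gr where
  toFun := DirectSum.map (grMapPiece α hα)
  map_add' := map_add _
  map_smul' a m := by
    rw [RingHom.id_apply]
    induction a using DirectSum.induction_on with
    | zero => rw [zero_smul, map_zero, zero_smul]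
    | add a b ha hb => rw [add_smul, map_add, ha, hb, add_smul]
    | of i a =>
      induction m using DirectSum.induction_on with
      | zero => rw [smul_zero, map_zero, smul_zero]
      | add m m' hm hm' => rw [smul_add, map_add, hm, hm', map_add, smul_add]
      | of j m =>
        rw [Gmodule.of_smul_of, DirectSum.map_of, DirectSum.map_of, Gmodule.of_smul_of]
        congr 1
        obtain ⟨a, rfl⟩ := F.exists_symbol a
        obtain ⟨m, rfl⟩ := G.exists_symbol m
        exact congrArg (H.symbol (i + j)) (Subtype.ext (α.map_smul (a : A) (m : M)))

/-- A map between graded modules is of degree `0`. -/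
def IsDegreeZero {G : ModuleFiltration F M} {H : ModuleFiltration F N}
    (φ : G.Gr →ₗ[F.Gr] H.Gr) : Prop :=
  ∀ k (a : G.GrPiece k), ∃ b : H.GrPiece k,
    φ (DirectSum.of G.GrPiece k a) = DirectSum.of H.GrPiece k b

/-! ### Free filtered modules and resolutions -/

/-- The filtration of `A^r` generated by the shift vector `ρ`: an element `(a_1, ..., a_r)` is in
the `k`-th step if and only if `ord a_j + ρ_j ≤ k` for all `j`. -/
def shiftFiltration (F : RingFiltration A) {r : ℕ} (ρ : Fin r → ℤ) :
    ModuleFiltration F (Fin r → A) where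
  fil k :=
    { carrier := {a | ∀ j, a j ∈ F.fil (k - ρ j)}
      add_mem' := fun ha hb j => add_mem (ha j) (hb j)
      zero_mem' := fun j => zero_mem _
      neg_mem' := fun ha j => neg_mem (ha j) }
  mono _ _ h _ ha j := F.mono (sub_le_sub_right h _) (ha j)
  smul_mem ha hm j := by
    have := F.mul_mem ha (hm j)
    rwa [← add_sub_assoc] at this
  exhaustive a := by
    choose k hk using fun j => F.exhaustive (a j)
    obtain ⟨K, hK⟩ := (Set.finite_range fun j => k j + ρ j).bddAbove
    exact ⟨K, fun j => F.mono (by have := hK ⟨j, rfl⟩; simp only at this; omega) (hk j)⟩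

/-- A sequence `... → gr A^{ρ₂} → gr A^{ρ₁} → gr A^{ρ₀} → gr M` of degree `0` morphisms of graded
`gr A`-modules, where the `A^{ρᵢ}` are free modules of finite rank, filtered by means of shift
vectors `ρᵢ`. -/
structure FreeGradedSequence (F : RingFiltration A) (G : ModuleFiltration F M) where
  /-- the ranks of the free modules -/
  rank : ℕ → ℕ
  /-- the shift vectors -/
  shift : ∀ i, Fin (rank i) → ℤ
  /-- the morphisms between the free modules -/
  d : ∀ i, (shiftFiltration F (shift (i + 1))).Gr →ₗ[F.Gr] (shiftFiltration F (shift i)).Gr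
  /-- the morphism to `gr M` -/
  aug : (shiftFiltration F (shift 0)).Gr →ₗ[F.Gr] G.Gr
  d_degreeZero : ∀ i, IsDegreeZero (d i)
  aug_degreeZero : IsDegreeZero aug

/-- The sequence is a free graded resolution of `gr M`: it is exact, also at `gr M`. -/
structure FreeGradedSequence.IsResolution {G : ModuleFiltration F M}
    (R : FreeGradedSequence F G) : Prop where
  aug_surjective : Function.Surjective R.aug
  exact_zero : Function.Exact (R.d 0) R.aug
  exact_succ : ∀ i, Function.Exact (R.d (i + 1)) (R.d i)

/-- A sequence `... → A^{ρ₂} → A^{ρ₁} → A^{ρ₀} → M` of morphisms of left `A`-modules that agree with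
the filtrations, where the `A^{ρᵢ}` are free modules of finite rank, filtered by means of shift
vectors `ρᵢ`. -/
structure FreeFilteredSequence (F : RingFiltration A) (G : ModuleFiltration F M) where
  /-- the ranks of the free modules -/
  rank : ℕ → ℕ
  /-- the shift vectors -/
  shift : ∀ i, Fin (rank i) → ℤ
  /-- the morphisms between the free modules -/
  d : ∀ i, (Fin (rank (i + 1)) → A) →ₗ[A] (Fin (rank i) → A)
  /-- the morphism to `M` -/
  aug : (Fin (rank 0) → A) →ₗ[A] M
  d_agrees : ∀ i, Agrees (shiftFiltration F (shift (i + 1))) (shiftFiltration F (shift i)) (d i)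
  aug_agrees : Agrees (shiftFiltration F (shift 0)) G aug

/-- The sequence is a free strict resolution of `M`: it is exact, also at `M`, and all its
morphisms are strict. -/
structure FreeFilteredSequence.IsStrictResolution {G : ModuleFiltration F M}
    (S : FreeFilteredSequence F G) : Prop where
  aug_surjective : Function.Surjective S.aug
  exact_zero : Function.Exact (S.d 0) S.aug
  exact_succ : ∀ i, Function.Exact (S.d (i + 1)) (S.d i)
  d_strict : ∀ i,
    IsStrict (shiftFiltration F (S.shift (i + 1))) (shiftFiltration F (S.shift i)) (S.d i)
  aug_strict : IsStrict (shiftFiltration F (S.shift 0)) G S.aug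

theorem isDegreeZero_grMap {G : ModuleFiltration F M} {H : ModuleFiltration F N} (α : M →ₗ[A] N)
    (hα : Agrees G H α) : IsDegreeZero (grMap α hα) :=
  fun k a => ⟨grMapPiece α hα k a, DirectSum.map_of _ _ _⟩

/-- The principal part of a filtered sequence: the sequence of the associated graded modules and
morphisms. -/
def FreeFilteredSequence.principalPart {G : ModuleFiltration F M}
    (S : FreeFilteredSequence F G) : FreeGradedSequence F G where
  rank := S.rank
  shift := S.shift
  d i := grMap (S.d i) (S.d_agrees i)
  aug := grMap S.aug S.aug_agrees
  d_degreeZero _ := isDegreeZero_grMap _ _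
  aug_degreeZero := isDegreeZero_grMap _ _

end Graded

end

section Lifting

variable {A : Type*} [Ring A] {F : RingFiltration A}
  {M : Type*} [AddCommGroup M] [Module A M] {N : Type*} [AddCommGroup N] [Module A N]

/-! The resolution is lifted one arrow at a time (`exists_strict_lift`). Given a strict `β : M → N`
and a graded map from a free module that is exact over `gr β`, represent the images of the basis
symbols by elements of `M`. Their images under `β` drop one step in the filtration; strictness of
`β` allows a correction by lower-order terms, which leaves the symbols unchanged, so that the
representatives lie in `ker β`. They define `α` on the free module, with the prescribed principal
part and `β ∘ α = 0`.

Exactness and strictness of `α` both come from `exists_fil_preimage`: an element of `ker β` of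
filtration level `k` is approximated by images of elements of level `k`, the error dropping one step
each time. This terminates because the filtration in the middle is bounded below. For free modules
that holds since operators of negative order vanish; for `M` it follows from separatedness and
surjectivity onto `gr M` (`exists_fil_eq_bot_of_surjective`). -/

theorem ModuleFiltration.symbol_eq_zero_iff {G : ModuleFiltration F M} {k : ℤ} (m : G.fil k) :
    G.symbol k m = 0 ↔ (m : M) ∈ G.fil (k - 1) :=
  QuotientAddGroup.eq_zero_iff m

theorem grMap_of_symbol {G : ModuleFiltration F M} {H : ModuleFiltration F N} (α : M →ₗ[A] N)
    (hα : Agrees G H α) (k : ℤ) (m : G.fil k) :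
    grMap α hα (DirectSum.of G.GrPiece k (G.symbol k m)) =
      DirectSum.of H.GrPiece k (H.symbol k ⟨α m, hα k m m.2⟩) :=
  DirectSum.map_of _ _ _

theorem ModuleFiltration.of_symbol_smul (G : ModuleFiltration F M) {i j k : ℤ} (h : i + j = k)
    {a : A} (ha : a ∈ F.fil i) {m : M} (hm : m ∈ G.fil j) (ham : a • m ∈ G.fil k) :
    DirectSum.of F.GrPiece i (F.symbol i ⟨a, ha⟩) • DirectSum.of G.GrPiece j (G.symbol j ⟨m, hm⟩) =
      DirectSum.of G.GrPiece k (G.symbol k ⟨a • m, ham⟩) := by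
  subst h
  exact Gmodule.of_smul_of _ _ _ _

/-- A morphism of degree `0` acts componentwise. -/
theorem IsDegreeZero.apply_of {G : ModuleFiltration F M} {H : ModuleFiltration F N}
    {φ : G.Gr →ₗ[F.Gr] H.Gr} (hφ : IsDegreeZero φ) (x : G.Gr) (k : ℤ) :
    φ (DirectSum.of G.GrPiece k (x k)) = DirectSum.of H.GrPiece k (φ x k) := by
  induction x using DirectSum.induction_on with
  | zero => simp
  | add x y hx hy => simp only [DirectSum.add_apply, map_add, hx, hy]
  | of i a =>
    obtain ⟨b, hb⟩ := hφ i a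
    rw [hb]
    by_cases h : i = k
    · subst h
      rw [DirectSum.of_eq_same, DirectSum.of_eq_same, hb]
    · rw [DirectSum.of_eq_of_ne _ _ _ (Ne.symm h), DirectSum.of_eq_of_ne _ _ _ (Ne.symm h)]
      simp

/-! ### Free filtered modules and the generators of their graded modules -/

theorem single_mem_shiftFiltration (F : RingFiltration A) {r : ℕ} (ρ : Fin r → ℤ) (j : Fin r)
    {i : ℤ} {a : A} (ha : a ∈ F.fil i) :
    (Pi.single j a : Fin r → A) ∈ (shiftFiltration F ρ).fil (i + ρ j) := by
  intro l
  by_cases h : l = j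
  · subst h
    simpa using ha
  · rw [Pi.single_eq_of_ne h]
    exact zero_mem _

theorem basis_mem_shiftFiltration (F : RingFiltration A) {r : ℕ} (ρ : Fin r → ℤ) (j : Fin r) :
    (Pi.single j 1 : Fin r → A) ∈ (shiftFiltration F ρ).fil (ρ j) := by
  simpa using single_mem_shiftFiltration F ρ j F.one_mem

/-- The principal symbols of the standard basis generate the associated graded module of a free
filtered module. -/
theorem of_symbol_shiftFiltration (F : RingFiltration A) {r : ℕ} (ρ : Fin r → ℤ) (k : ℤ)
    (a : (shiftFiltration F ρ).fil k) :
    DirectSum.of (shiftFiltration F ρ).GrPiece k ((shiftFiltration F ρ).symbol k a) =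
      ∑ j, DirectSum.of F.GrPiece (k - ρ j) (F.symbol (k - ρ j) ⟨(a : Fin r → A) j, a.2 j⟩) •
        DirectSum.of (shiftFiltration F ρ).GrPiece (ρ j)
          ((shiftFiltration F ρ).symbol (ρ j) ⟨Pi.single j 1, basis_mem_shiftFiltration F ρ j⟩) := by
  have hmem (j : Fin r) : (a : Fin r → A) j • (Pi.single j 1 : Fin r → A) ∈
      (shiftFiltration F ρ).fil k := by
    rw [← Pi.single_smul, smul_eq_mul, mul_one]
    simpa using single_mem_shiftFiltration F ρ j (a.2 j)
  have hsum : a = ∑ j, (⟨_, hmem j⟩ : (shiftFiltration F ρ).fil k) := by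
    ext1
    rw [AddSubgroup.val_finsetSum]
    exact pi_eq_sum_univ' (a : Fin r → A)
  conv_lhs => rw [hsum]
  rw [map_sum, map_sum]
  refine Finset.sum_congr rfl fun j _ => ?_
  exact (ModuleFiltration.of_symbol_smul _ (sub_add_cancel _ _) _ _ _).symm

/-- The basis symbols generate over `gr A`. This identifies the principal part of a lift that was
constructed only on the basis. -/
theorem shiftFiltration_hom_ext {r : ℕ} {ρ : Fin r → ℤ} {G : ModuleFiltration F M}
    {φ ψ : (shiftFiltration F ρ).Gr →ₗ[F.Gr] G.Gr}
    (h : ∀ j, φ (DirectSum.of (shiftFiltration F ρ).GrPiece (ρ j)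
        ((shiftFiltration F ρ).symbol (ρ j) ⟨Pi.single j 1, basis_mem_shiftFiltration F ρ j⟩)) =
      ψ (DirectSum.of (shiftFiltration F ρ).GrPiece (ρ j)
        ((shiftFiltration F ρ).symbol (ρ j) ⟨Pi.single j 1, basis_mem_shiftFiltration F ρ j⟩))) :
    φ = ψ := by
  ext1 y
  induction y using DirectSum.induction_on with
  | zero => rw [map_zero, map_zero]
  | add y z hy hz => rw [map_add, map_add, hy, hz]
  | of k a =>
    obtain ⟨a, rfl⟩ := ModuleFiltration.exists_symbol a
    rw [of_symbol_shiftFiltration, map_sum, map_sum]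
    refine Finset.sum_congr rfl fun j _ => ?_
    rw [map_smul, map_smul, h]

theorem agrees_linearCombination {r : ℕ} {ρ : Fin r → ℤ} {G : ModuleFiltration F M}
    {v : Fin r → M} (hv : ∀ j, v j ∈ G.fil (ρ j)) :
    Agrees (shiftFiltration F ρ) G (Fintype.linearCombination A v) := by
  intro k a ha
  rw [Fintype.linearCombination_apply]
  refine sum_mem fun j _ => ?_
  simpa using G.smul_mem (ha j) (hv j)

/-! ### Filtrations bounded below and lifting of exactness -/

theorem shiftFiltration_eq_bot (hF : ∀ k < 0, F.fil k = ⊥) {r : ℕ} (ρ : Fin r → ℤ) :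
    ∃ k₀, (shiftFiltration F ρ).fil k₀ = ⊥ := by
  obtain ⟨K, hK⟩ := (Set.finite_range ρ).bddBelow
  -- `K` bounds the shifts from below, so at level `K - 1` every component has order at most `K - 1
  -- - ρ j < 0`.
  refine ⟨K - 1, (AddSubgroup.eq_bot_iff_forall _).2 fun a ha => funext fun j => ?_⟩
  have h := ha j
  rw [hF _ (by have := hK ⟨j, rfl⟩; omega)] at h
  exact AddSubgroup.mem_bot.1 h

/-- A separated filtration whose associated graded module is a quotient of that of a free filtered
module of finite rank is bounded below. -/
theorem exists_fil_eq_bot_of_surjective (hF : ∀ k < 0, F.fil k = ⊥) {G : ModuleFiltration F M}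
    (hsep : ∀ m : M, (∀ k : ℤ, m ∈ G.fil k) → m = 0) {r : ℕ} {ρ : Fin r → ℤ}
    {φ : (shiftFiltration F ρ).Gr →ₗ[F.Gr] G.Gr} (hφ : IsDegreeZero φ)
    (hs : Function.Surjective φ) : ∃ k₀, G.fil k₀ = ⊥ := by
  obtain ⟨k₀, hk₀⟩ := shiftFiltration_eq_bot hF ρ
  -- Below `k₀` the graded free module vanishes, hence so does its quotient `gr M`: the filtration
  -- of `M` is constant there, and separatedness makes it zero.
  have hstep (k : ℤ) (hk : k ≤ k₀) (m : M) (hm : m ∈ G.fil k) : m ∈ G.fil (k - 1) := by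
    rw [← ModuleFiltration.symbol_eq_zero_iff ⟨m, hm⟩]
    obtain ⟨y, hy⟩ := hs (DirectSum.of G.GrPiece k (G.symbol k ⟨m, hm⟩))
    have h := hφ.apply_of y k
    obtain ⟨a, ha⟩ := ModuleFiltration.exists_symbol (y k)
    have ha0 : a = 0 := by
      have h' := (shiftFiltration F ρ).mono hk a.2
      rw [hk₀, AddSubgroup.mem_bot] at h'
      exact Subtype.ext h'
    rw [← ha, ha0, map_zero, map_zero, map_zero, hy, DirectSum.of_eq_same] at h
    exact (DirectSum.of_injective (β := G.GrPiece) k (h.symm.trans (map_zero _).symm))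
  refine ⟨k₀, (AddSubgroup.eq_bot_iff_forall _).2 fun m hm => hsep m fun k => ?_⟩
  rcases le_total k k₀ with hk | hk
  · induction k, hk using Int.leInductionDown with
    | base => exact hm
    | pred k hk ih => exact hstep k hk m ih
  · exact G.mono hk hm

/-- Exactness of the associated graded sequence lifts to the filtered sequence, with control of the
filtrations, if the filtration in the middle is bounded below. -/
theorem exists_fil_preimage {L : Type*} [AddCommGroup L] [Module A L] {E : ModuleFiltration F L}
    {G : ModuleFiltration F M} {H : ModuleFiltration F N} {α : L →ₗ[A] M} {β : M →ₗ[A] N}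
    (hα : Agrees E G α) (hβ : Agrees G H β) (hβα : ∀ a, β (α a) = 0)
    (hex : Function.Exact (grMap α hα) (grMap β hβ)) (hG : ∃ k₀, G.fil k₀ = ⊥) (k : ℤ) (m : M)
    (hm : m ∈ G.fil k) (hm0 : β m = 0) : ∃ a ∈ E.fil k, α a = m := by
  obtain ⟨k₀, hk₀⟩ := hG
  rcases le_total k k₀ with hk | hk
  · have h := G.mono hk hm
    rw [hk₀, AddSubgroup.mem_bot] at h
    exact ⟨0, zero_mem _, by rw [map_zero, h]⟩
  induction k, hk using Int.leInduction generalizing m with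
  | base =>
    rw [hk₀, AddSubgroup.mem_bot] at hm
    exact ⟨0, zero_mem _, by rw [map_zero, hm]⟩
  | succ k hk ih =>
    have h0 : grMap β hβ (DirectSum.of G.GrPiece (k + 1) (G.symbol (k + 1) ⟨m, hm⟩)) = 0 := by
      rw [grMap_of_symbol, (ModuleFiltration.symbol_eq_zero_iff _).2, map_zero]
      change β m ∈ _
      rw [hm0]
      exact zero_mem _
    obtain ⟨y, hy⟩ := (hex _).1 h0
    -- The preimage `y` need not be homogeneous; since `gr α` has degree `0`, its component of
    -- degree `k + 1` already maps to the symbol of `m`.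
    obtain ⟨a, ha⟩ := ModuleFiltration.exists_symbol (y (k + 1))
    have h := (isDegreeZero_grMap α hα).apply_of y (k + 1)
    rw [hy, DirectSum.of_eq_same, ← ha, grMap_of_symbol] at h
    have h1 := DirectSum.of_injective (β := G.GrPiece) (k + 1) h
    rw [← sub_eq_zero, ← map_sub, ModuleFiltration.symbol_eq_zero_iff, add_sub_cancel_right] at h1
    have h2 := neg_mem h1
    rw [← AddSubgroup.coe_neg, neg_sub] at h2
    -- The error `m - α a` has level `k` and is still killed by `β`.
    obtain ⟨b, hb, hbm⟩ := ih (m - α a) h2 (by rw [map_sub, hm0, hβα, sub_zero])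
    exact ⟨b + a, add_mem (E.mono (by omega) hb) a.2, by rw [map_add, hbm, sub_add_cancel]⟩

/-- A degree `0` morphism from a free graded module that is exact over the principal part of a
strict morphism is the principal part of a strict morphism that is exact over it. -/
theorem exists_strict_lift {G : ModuleFiltration F M} {H : ModuleFiltration F N} {β : M →ₗ[A] N}
    (hβ : IsStrict G H β) (hG : ∃ k₀, G.fil k₀ = ⊥) {r : ℕ} {ρ : Fin r → ℤ}
    {φ : (shiftFiltration F ρ).Gr →ₗ[F.Gr] G.Gr} (hφ : IsDegreeZero φ)
    (hex : Function.Exact φ (grMap β hβ.1)) :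
    ∃ (α : (Fin r → A) →ₗ[A] M) (hα : IsStrict (shiftFiltration F ρ) G α),
      grMap α hα.1 = φ ∧ Function.Exact α β := by
  have hlift (j : Fin r) : ∃ m : G.fil (ρ j), β m = 0 ∧
      φ (DirectSum.of (shiftFiltration F ρ).GrPiece (ρ j) ((shiftFiltration F ρ).symbol (ρ j)
        ⟨Pi.single j 1, basis_mem_shiftFiltration F ρ j⟩)) =
      DirectSum.of G.GrPiece (ρ j) (G.symbol (ρ j) m) := by
    obtain ⟨c, hc⟩ := hφ (ρ j) ((shiftFiltration F ρ).symbol (ρ j)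
      ⟨Pi.single j 1, basis_mem_shiftFiltration F ρ j⟩)
    obtain ⟨m, rfl⟩ := ModuleFiltration.exists_symbol c
    have h0 := hex.apply_apply_eq_zero (DirectSum.of (shiftFiltration F ρ).GrPiece (ρ j)
      ((shiftFiltration F ρ).symbol (ρ j) ⟨Pi.single j 1, basis_mem_shiftFiltration F ρ j⟩))
    rw [hc, grMap_of_symbol] at h0
    have h1 := DirectSum.of_injective (β := H.GrPiece) (ρ j) (h0.trans (map_zero _).symm)
    rw [ModuleFiltration.symbol_eq_zero_iff] at h1
    -- The vanishing symbol puts `β m` at level `ρ j - 1`; strictness gives `m'` of that same level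
    -- with the same image. Subtracting it kills `β m` without changing the symbol of `m`.
    obtain ⟨m', hm', hmm'⟩ : β m ∈ β '' (G.fil (ρ j - 1) : Set M) := by
      rw [hβ.2]
      exact ⟨⟨_, rfl⟩, h1⟩
    have hm'' : m' ∈ G.fil (ρ j) := G.mono (by omega) hm'
    refine ⟨m - ⟨m', hm''⟩, ?_, ?_⟩
    · rw [AddSubgroup.coe_sub, map_sub, hmm', sub_self]
    · rw [hc, map_sub, (ModuleFiltration.symbol_eq_zero_iff ⟨m', hm''⟩).2 hm', sub_zero]
  choose v hv0 hv using hlift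
  have hα := agrees_linearCombination (F := F) (G := G) (fun j => (v j).2)
  set α := Fintype.linearCombination A fun j => (v j : M) with hα_def
  have hgr : grMap α hα = φ := by
    refine shiftFiltration_hom_ext fun j => ?_
    rw [hv, grMap_of_symbol]
    congr 2
    ext1
    change α (Pi.single j 1) = _
    rw [hα_def, Fintype.linearCombination_apply_single, one_smul]
  have hβα (a : Fin r → A) : β (α a) = 0 := by
    rw [hα_def, Fintype.linearCombination_apply, map_sum]
    exact Finset.sum_eq_zero fun j _ => by rw [map_smul, hv0, smul_zero]
  have hpre := exists_fil_preimage hα hβ.1 hβα (hgr ▸ hex) hG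
  refine ⟨α, ⟨hα, fun k => Set.Subset.antisymm ?_ ?_⟩, hgr, fun m => ⟨fun hm => ?_, ?_⟩⟩
  · rintro _ ⟨a, ha, rfl⟩
    exact ⟨⟨a, rfl⟩, hα k a ha⟩
  · rintro _ ⟨⟨a, rfl⟩, ha⟩
    exact hpre k _ ha (hβα a)
  · obtain ⟨k, hk⟩ := G.exhaustive m
    obtain ⟨a, -, ha⟩ := hpre k m hk hm
    exact ⟨a, ha⟩
  · rintro ⟨a, rfl⟩
    exact hβα a

/-! ### Construction of the resolution -/

theorem isStrict_zero (G : ModuleFiltration F M) (H : ModuleFiltration F N) :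
    IsStrict G H (0 : M →ₗ[A] N) := by
  refine ⟨fun k m _ => zero_mem _, fun k => Set.ext fun m => ⟨?_, ?_⟩⟩
  · rintro ⟨a, -, rfl⟩
    exact ⟨⟨a, rfl⟩, zero_mem _⟩
  · rintro ⟨⟨a, rfl⟩, -⟩
    exact ⟨0, zero_mem _, rfl⟩

theorem grMap_zero_apply {G : ModuleFiltration F M} {H : ModuleFiltration F N}
    (h : Agrees G H (0 : M →ₗ[A] N)) (y : G.Gr) : grMap 0 h y = 0 := by
  induction y using DirectSum.induction_on with
  | zero => rw [map_zero]
  | add y z hy hz => rw [map_add, hy, hz, add_zero]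
  | of k a =>
    obtain ⟨a, rfl⟩ := ModuleFiltration.exists_symbol a
    rw [grMap_of_symbol, (ModuleFiltration.symbol_eq_zero_iff _).2 (zero_mem _), map_zero]

theorem FreeGradedSequence.mk_eq_self {G : ModuleFiltration F M} (R : FreeGradedSequence F G)
    {d : ∀ i, (shiftFiltration F (R.shift (i + 1))).Gr →ₗ[F.Gr] (shiftFiltration F (R.shift i)).Gr}
    {aug : (shiftFiltration F (R.shift 0)).Gr →ₗ[F.Gr] G.Gr} {hd : ∀ i, IsDegreeZero (d i)}
    {haug : IsDegreeZero aug} (h : d = R.d) (h' : aug = R.aug) :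
    (⟨R.rank, R.shift, d, aug, hd, haug⟩ : FreeGradedSequence F G) = R := by
  subst h h'
  rfl

/-- A free graded resolution of `gr M` is the principal part of a free strict resolution of `M`. -/
theorem FreeGradedSequence.IsResolution.exists_strictResolution (hF : ∀ k < 0, F.fil k = ⊥)
    {G : ModuleFiltration F M} (hsep : ∀ m : M, (∀ k : ℤ, m ∈ G.fil k) → m = 0)
    {R : FreeGradedSequence F G} (hR : R.IsResolution) :
    ∃ S : FreeFilteredSequence F G, S.IsStrictResolution ∧ S.principalPart = R := by
  -- The augmentation is lifted over the zero map `M → M`, for which exactness means surjectivity.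
  obtain ⟨π, hπ, hgrπ, hπex⟩ := exists_strict_lift (isStrict_zero G G)
    (exists_fil_eq_bot_of_surjective hF hsep R.aug_degreeZero hR.aug_surjective) R.aug_degreeZero
    (fun y => iff_of_true (grMap_zero_apply _ y) (hR.aug_surjective y))
  obtain ⟨d₀, hd₀, hgr₀, hex₀⟩ := exists_strict_lift hπ (shiftFiltration_eq_bot hF (R.shift 0))
    (R.d_degreeZero 0) (hgrπ ▸ hR.exact_zero)
  -- The recursion carries strictness and the principal part, all that the next lift needs;
  -- exactness relates consecutive terms and is recorded in `hnext`.
  let T (i : ℕ) : Type _ := {α : (Fin (R.rank (i + 1)) → A) →ₗ[A] (Fin (R.rank i) → A) //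
    ∃ h : IsStrict (shiftFiltration F (R.shift (i + 1))) (shiftFiltration F (R.shift i)) α,
      grMap α h.1 = R.d i}
  have hstep (i : ℕ) (t : T i) : ∃ t' : T (i + 1), Function.Exact t'.1 t.1 := by
    obtain ⟨α, h, hgr⟩ := t
    obtain ⟨α', h', hgr', hex'⟩ := exists_strict_lift h (shiftFiltration_eq_bot hF (R.shift (i + 1)))
      (R.d_degreeZero (i + 1)) (hgr ▸ hR.exact_succ i)
    exact ⟨⟨α', h', hgr'⟩, hex'⟩
  choose next hnext using hstep
  let d (i : ℕ) : T i := Nat.rec ⟨d₀, hd₀, hgr₀⟩ next i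
  refine ⟨⟨R.rank, R.shift, fun i => (d i).1, π, fun i => (d i).2.choose.1, hπ.1⟩,
    ⟨fun m => (hπex m).1 rfl, hex₀, fun i => hnext i (d i), fun i => (d i).2.choose, hπ⟩,
    R.mk_eq_self (funext fun i => (d i).2.choose_spec) hgrπ⟩

end Lifting

/-- No list has negative length, so the spanning set is empty. -/
theorem orderFiltration_fil_eq_bot {n : ℕ} (x : EuclideanSpace ℝ (Fin n)) {k : ℤ} (hk : k < 0) :
    (orderFiltration x).fil k = ⊥ := by
  refine (AddSubgroup.eq_bot_iff_forall _).2 fun a ha => Subtype.ext ?_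
  have h : orderLE x k = ⊥ := by
    rw [orderLE, Submodule.span_eq_bot]
    rintro w ⟨l, hl, -⟩
    omega
  have ha' : (a : Module.End ℂ (AnalyticGerm x)) ∈ orderLE x k := ha
  rwa [h, Submodule.mem_bot] at ha'

theorem mainTheorem9 {n : ℕ} (x : EuclideanSpace ℝ (Fin n)) {M : Type*} [AddCommGroup M]
    [Module (DiffOp x) M] (G : ModuleFiltration (orderFiltration x) M)
    (hsep : ∀ m : M, (∀ k : ℤ, m ∈ G.fil k) → m = 0)
    (R : FreeGradedSequence (orderFiltration x) G) (hR : R.IsResolution) :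
    ∃ S : FreeFilteredSequence (orderFiltration x) G,
      S.IsStrictResolution ∧ S.principalPart = R :=
  hR.exists_strictResolution (fun _ hk => orderFiltration_fil_eq_bot x hk) hsep
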